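/- Let $d\ge 3$. A $k$-facet of $\mathbb Z^d$ is a set $x+(A_1\times\dots\times A_d)$ with $x\in\mathbb Z^d$, exactly $k$ of the sets $A_i$ equal to $\{0,1\}$ and the others equal to $\{0\}$; $1$-facets are called edges and $(d-1)$-facets plaquettes, and two facets of different dimensions are incident if one is a subset of the other. A surface is a connected set of plaquettes (two plaquettes being adjacent if some $(d-2)$-facet is incident to both) such that every $(d-2)$-facet is incident to an even number of its elements. A set of plaquettes separates a vertex $x$ from infinity if every infinite self-avoiding nearest-neighbour path of $\mathbb Z^d$ starting at $x$ contains a vertex incident to one of these plaquettes. Consider bond percolation on $\mathbb Z^d$: each edge is open with probability $p$, independently of the others, with law $\mathbb P_p$; the open clusters are the connected components of the graph formed by $\mathbb Z^d$ and the open edges. Let $X$ be the set of vertices lying in no infinite open cluster, regarded as an induced subgraph of the lattice $\mathbb Z^d$, and let $$p_{\mathrm{fin}}(d)=\sup\{p\in[0,1]:\ \mathbb P_p(X\text{ has an infinite connected component})>0\}.$$ Then $p_{\mathrm{fin}}(d)<1$. Moreover, there exists $p_0=p_0(d)<1$ such that, for every $p\in[0,1]$ with $p>p_0$, $\mathbb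 P_p$-almost surely there is a unique infinite open cluster $I$, and every vertex $x\in\mathbb Z^d$ is separated from infinity by a finite surface of plaquettes of $\mathbb Z^d$ such that every edge incident to (i.e. contained in) a plaquette of the surface is open and every vertex incident to the surface lies in $I$. -/

import Mathlib

open MeasureTheory ProbabilityTheory

namespace PercPlaq

/-- The facet `x + (A₁ × ⋯ × A_d)` of `ℤ^d`, where `A_i = {0, 1}` for `i ∈ J` and
`A_i = {0}` for `i ∉ J`. -/
def facet {d : ℕ} (x : Fin d → ℤ) (J : Finset (Fin d)) : Set (Fin d → ℤ) :=
  {y | ∀ i, y i = x i ∨ (i ∈ J ∧ y i = x i + 1)}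

/-- `F` is a `k`-facet of `ℤ^d`. A facet is incident to a facet of another dimension when one is a
subset of the other. -/
def IsFacet {d : ℕ} (k : ℕ) (F : Set (Fin d → ℤ)) : Prop :=
  ∃ (x : Fin d → ℤ) (J : Finset (Fin d)), J.card = k ∧ F = facet x J

/-- The edges of the lattice: the `1`-facets of `ℤ^d`. -/
abbrev Edge (d : ℕ) : Type := {e : Set (Fin d → ℤ) // IsFacet 1 e}

/-- The hypercubic lattice, as a graph on `ℤ^d`. -/
def lattice (d : ℕ) : SimpleGraph (Fin d → ℤ) where
  Adj x y := x ≠ y ∧ IsFacet 1 {x, y}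
  symm := ⟨fun x y h => ⟨h.1.symm, by rw [Set.pair_comm]; exact h.2⟩⟩
  loopless := ⟨fun _ h => h.1 rfl⟩

/-- Percolation configurations; `ω e = true` means that the edge `e` is open. -/
abbrev Config (d : ℕ) : Type := Edge d → Bool

/-- Product measure on configurations: every edge is open with probability `p`. -/
noncomputable def percMeasure (d : ℕ) (p : unitInterval) : Measure (Config d) :=
  Measure.infinitePi fun _ : Edge d => bernoulliMeasure true false p

/-- The graph on `ℤ^d` formed by the open edges. Its connected components are the open clusters. -/
def openGraph {d : ℕ} (ω : Config d) : SimpleGraph (Fin d → ℤ) where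
  Adj x y := x ≠ y ∧ ∃ h : IsFacet 1 {x, y}, ω ⟨{x, y}, h⟩ = true
  symm := ⟨fun x y h => ⟨h.1.symm, by rw [Set.pair_comm]; exact h.2⟩⟩
  loopless := ⟨fun _ h => h.1 rfl⟩

/-- The set `X` of vertices that lie in no infinite open cluster. -/
def finiteClusterSet {d : ℕ} (ω : Config d) : Set (Fin d → ℤ) :=
  {x | ((openGraph ω).connectedComponentMk x).supp.Finite}

/-- The event that the subgraph of the lattice induced by `X` has an infinite connected
component. -/
def infiniteComponentEvent (d : ℕ) : Set (Config d) :=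
  {ω | ∃ C : ((lattice d).induce (finiteClusterSet ω)).ConnectedComponent, C.supp.Infinite}

/-- The critical probability `p_fin(d)`: the supremum of all `p ∈ [0, 1]` such that `X` has an
infinite connected component with positive probability. -/
noncomputable def pFin (d : ℕ) : ℝ :=
  sSup {p : ℝ | ∃ h : p ∈ unitInterval, 0 < percMeasure d ⟨p, h⟩ (infiniteComponentEvent d)}

/-- The plaquettes of `ℤ^d`, that is, its `(d - 1)`-facets (for `d ≥ 1`). -/
abbrev Plaquette (d : ℕ) : Type := {π : Set (Fin d → ℤ) // IsFacet (d - 1) π}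

/-- Distinct plaquettes are adjacent when some `(d - 2)`-facet is incident to both (`d ≥ 2`). -/
def plaquetteGraph (d : ℕ) : SimpleGraph (Plaquette d) where
  Adj π₁ π₂ := π₁ ≠ π₂ ∧ ∃ f : Set (Fin d → ℤ), IsFacet (d - 2) f ∧ f ⊆ π₁.1 ∧ f ⊆ π₂.1
  symm := ⟨fun _ _ h => ⟨h.1.symm, h.2.imp fun _ hf => ⟨hf.1, hf.2.2, hf.2.1⟩⟩⟩
  loopless := ⟨fun _ h => h.1 rfl⟩

/-- The boundary of a set of plaquettes: the `(d - 2)`-facets incident to an odd number of its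
elements. Every `(d - 2)`-facet is incident to finitely many plaquettes. -/
def plaquetteBoundary {d : ℕ} (P : Set (Plaquette d)) : Set (Set (Fin d → ℤ)) :=
  {f | IsFacet (d - 2) f ∧ Odd {π | π ∈ P ∧ f ⊆ π.1}.ncard}

/-- A surface: a connected set of plaquettes with empty boundary. -/
def IsSurface {d : ℕ} (P : Set (Plaquette d)) : Prop :=
  ((plaquetteGraph d).induce P).Connected ∧ plaquetteBoundary P = ∅

/-- An infinite path of the lattice: its successive vertices are adjacent, and no vertex is
repeated. -/
def IsInfinitePath {d : ℕ} (v : ℕ → Fin d → ℤ) : Prop :=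
  Function.Injective v ∧ ∀ n, (lattice d).Adj (v n) (v (n + 1))

/-- A set `P` of plaquettes of `ℤ^d` separates `A` from infinity: every infinite path starting in
`A` contains a vertex incident to an element of `P`. -/
def SeparatesFromInfinity {d : ℕ} (P : Set (Plaquette d)) (A : Set (Fin d → ℤ)) : Prop :=
  ∀ v : ℕ → Fin d → ℤ, IsInfinitePath v → v 0 ∈ A → ∃ n, ∃ π ∈ P, v n ∈ π.1

/-- A plaquette of `ℤ^d` is good if every edge incident to it is open. -/
def IsGood {d : ℕ} (ω : Config d) (π : Plaquette d) : Prop :=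
  ∀ e : Edge d, e.1 ⊆ π.1 → ω e = true

end PercPlaq

namespace PercPlaq

/-! Peierls argument combined with duality modulo two. Call a vertex bad if one of the `d` edges
leaving it in a positive direction is closed. For `p` near 1 the clusters of bad vertices, with
sup-distance adjacency, have exponentially small tails (`percMeasure_far_le_half`), so
Borel–Cantelli controls them all.

Represent a unit cube by its lower corner. Add to a set `A` of cubes every cube touching a bad
cluster that touches `A`. No plaquette on the boundary of this hull contains a bad vertex, so all
its edges are open. The boundary is a cycle modulo two, and so is each of its components. Counting
crossings along a ray shows that some component surrounds a given cube of `A`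
(`exists_surface_cubeBoundary`). This component is a surface, and its vertices lie in one open
cluster.

If `A` is a half-line, the surface is infinite and gives an infinite cluster `I`
(`exists_infinite_cluster`). If `A` is a path from `x` to a vertex of `I`, the surface is finite
(`exists_finite_surface`); `I` must meet it, so its vertices lie in `I`. Another infinite cluster
through `x` would meet it too, which gives uniqueness. An infinite component of `X` would also have
to meet such a surface, but `X` and `I` are disjoint. -/

variable {d : ℕ}

/-! ### Facets, edges and plaquettes in coordinates -/

/-- The `i`-th unit vector of `ℤ^d`. -/
def unitVec (i : Fin d) : Fin d → ℤ := Pi.single i 1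

lemma unitVec_same (i : Fin d) : unitVec i i = 1 := by simp [unitVec]

lemma unitVec_ne {i j : Fin d} (h : j ≠ i) : unitVec i j = 0 := by simp [unitVec, h]

lemma unitVec_apply (i j : Fin d) : unitVec i j = if j = i then 1 else 0 := by
  simp [unitVec, Pi.single_apply]

lemma self_mem_facet (x : Fin d → ℤ) (J : Finset (Fin d)) : x ∈ facet x J := fun _ => Or.inl rfl

lemma facet_finite (x : Fin d → ℤ) (J : Finset (Fin d)) : (facet x J).Finite := by
  refine (Set.finite_Icc x (x + 1)).subset fun y hy => ⟨fun i => ?_, fun i => ?_⟩ <;>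
  · have := hy i
    simp only [Pi.add_apply, Pi.one_apply]
    omega

lemma facet_mono (x : Fin d → ℤ) {J J' : Finset (Fin d)} (h : J ⊆ J') :
    facet x J ⊆ facet x J' := fun _ hy i => (hy i).imp_right fun hi => ⟨h hi.1, hi.2⟩

lemma add_unitVec_mem_facet {x y : Fin d → ℤ} {J : Finset (Fin d)} {i : Fin d} (hi : i ∈ J)
    (hy : y ∈ facet x J) (hyi : y i = x i) : y + unitVec i ∈ facet x J := by
  intro j
  by_cases h : j = i
  · subst h; right; simp [hi, unitVec_same, hyi]
  · simpa [unitVec_ne h] using hy j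

lemma facet_subset_facet {x y : Fin d → ℤ} {J J' : Finset (Fin d)} (h : facet x J ⊆ facet y J') :
    J ⊆ J' ∧ ∀ i, (x i = y i ∨ (x i = y i + 1 ∧ i ∈ J')) ∧ (i ∈ J → x i = y i) := by
  have h1 : ∀ i ∈ J, i ∈ J' ∧ x i = y i := fun i hi => by
    have ha := h (self_mem_facet x J) i
    have hb := h (add_unitVec_mem_facet hi (self_mem_facet x J) rfl) i
    simp only [Pi.add_apply, unitVec_same] at hb
    grind
  refine ⟨fun i hi => (h1 i hi).1, fun i => ⟨?_, fun hi => (h1 i hi).2⟩⟩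
  have := h (self_mem_facet x J) i
  tauto

lemma facet_injective {x y : Fin d → ℤ} {J J' : Finset (Fin d)} (h : facet x J = facet y J') :
    x = y ∧ J = J' := by
  have h1 := facet_subset_facet h.le
  have h2 := facet_subset_facet h.ge
  refine ⟨funext fun i => ?_, h1.1.antisymm h2.1⟩
  have := (h1.2 i).1
  have := (h2.2 i).1
  omega

lemma facet_singleton (x : Fin d → ℤ) (i : Fin d) : facet x {i} = {x, x + unitVec i} := by
  ext y
  constructor
  · intro hy
    rcases hy i with h | h
    · left
      ext j
      rcases hy j with h' | h'
      · exact h'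
      · have := Finset.mem_singleton.1 h'.1
        subst this; exact h
    · right
      ext j
      by_cases hj : j = i
      · subst hj; simp [h.2, unitVec_same]
      · rcases hy j with h' | h'
        · simp [h', unitVec_ne hj]
        · exact absurd (Finset.mem_singleton.1 h'.1) hj
  · rintro (rfl | rfl)
    · exact self_mem_facet _ _
    · exact add_unitVec_mem_facet (Finset.mem_singleton_self i) (self_mem_facet _ _) rfl

/-- The edge from `x` to `x + unitVec i`. -/
def edge (x : Fin d → ℤ) (i : Fin d) : Edge d := ⟨facet x {i}, x, {i}, Finset.card_singleton i, rfl⟩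

lemma edge_injective {x y : Fin d → ℤ} {i j : Fin d} (h : edge x i = edge y j) : x = y ∧ i = j := by
  have := facet_injective (congrArg Subtype.val h)
  exact ⟨this.1, Finset.singleton_injective this.2⟩

lemma exists_eq_edge (e : Edge d) : ∃ x i, e = edge x i := by
  obtain ⟨e, x, J, hJ, rfl⟩ := e
  obtain ⟨i, rfl⟩ := Finset.card_eq_one.1 hJ
  exact ⟨x, i, rfl⟩

lemma lattice_adj_iff {x y : Fin d → ℤ} :
    (lattice d).Adj x y ↔ ∃ i, y = x + unitVec i ∨ x = y + unitVec i := by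
  constructor
  · rintro ⟨hne, z, J, hJ, h⟩
    obtain ⟨i, rfl⟩ := Finset.card_eq_one.1 hJ
    rw [facet_singleton] at h
    refine ⟨i, ?_⟩
    have hx : x ∈ ({z, z + unitVec i} : Set _) := h ▸ (by simp)
    have hy : y ∈ ({z, z + unitVec i} : Set _) := h ▸ (by simp)
    rcases hx with hx | hx <;> rcases hy with hy | hy
    · exact absurd (hx.trans hy.symm) hne
    · left; rw [hx]; exact hy
    · right; rw [hy]; exact hx
    · exact absurd (hx.trans hy.symm) hne
  · have key : ∀ (x : Fin d → ℤ) i, (lattice d).Adj x (x + unitVec i) := fun x i =>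
      ⟨fun h => by simpa [unitVec_same] using congrFun h i,
        x, {i}, Finset.card_singleton i, (facet_singleton x i).symm⟩
    rintro ⟨i, rfl | rfl⟩
    · exact key _ _
    · exact (key _ _).symm

lemma lattice_adj_add (x : Fin d → ℤ) (i : Fin d) : (lattice d).Adj x (x + unitVec i) :=
  lattice_adj_iff.2 ⟨i, Or.inl rfl⟩

lemma openGraph_adj_add {ω : Config d} {x : Fin d → ℤ} {i : Fin d} (h : ω (edge x i) = true) :
    (openGraph ω).Adj x (x + unitVec i) := by
  refine ⟨(lattice_adj_add x i).1, (lattice_adj_add x i).2, ?_⟩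
  convert h using 2
  exact Subtype.ext (facet_singleton x i).symm

lemma openGraph_le_lattice (ω : Config d) : openGraph ω ≤ lattice d := fun _ _ h => ⟨h.1, h.2.1⟩

lemma lattice_reachable (x z : Fin d → ℤ) : (lattice d).Reachable x z := by
  have hnat : ∀ (n : ℕ) (y : Fin d → ℤ) i, (lattice d).Reachable y (y + n • unitVec i) := by
    intro n y i
    induction n with
    | zero => simp
    | succ n ih =>
      refine ih.trans ?_
      rw [succ_nsmul, ← add_assoc]
      exact (lattice_adj_add _ i).reachable
  have hint : ∀ (m : ℤ) (y : Fin d → ℤ) i, (lattice d).Reachable y (y + m • unitVec i) := by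
    intro m y i
    obtain ⟨n, rfl | rfl⟩ := m.eq_nat_or_neg
    · simpa using hnat n y i
    · have := (hnat n (y + (-(n : ℤ)) • unitVec i) i).symm
      simpa [add_assoc] using this
  have key : ∀ T : Finset (Fin d), (lattice d).Reachable x (x + ∑ i ∈ T, (z i - x i) • unitVec i) := by
    intro T
    induction T using Finset.induction_on with
    | empty => simp
    | insert i T hi ih =>
      rw [Finset.sum_insert hi, add_comm (_ • unitVec i), ← add_assoc]
      exact ih.trans (hint _ _ _)
  convert key Finset.univ
  ext j
  simp [Finset.sum_apply, unitVec_apply]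

/-- The plaquette with lower corner `x` orthogonal to the direction `i`. -/
def plaq (x : Fin d → ℤ) (i : Fin d) : Plaquette d :=
  ⟨facet x (Finset.univ.erase i), x, _, by simp, rfl⟩

lemma plaq_injective {x y : Fin d → ℤ} {i j : Fin d} (h : plaq x i = plaq y j) :
    x = y ∧ i = j := by
  have := facet_injective (congrArg Subtype.val h)
  refine ⟨this.1, ?_⟩
  by_contra hne
  have h2 : i ∈ Finset.univ.erase i := this.2 ▸ (by simp [hne])
  simp at h2

lemma plaq_eq_iff {x y : Fin d → ℤ} {i j : Fin d} : plaq x i = plaq y j ↔ x = y ∧ i = j :=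
  ⟨plaq_injective, by rintro ⟨rfl, rfl⟩; rfl⟩

lemma exists_eq_plaq (hd : 1 ≤ d) (π : Plaquette d) : ∃ x i, π = plaq x i := by
  obtain ⟨π, x, J, hJ, rfl⟩ := π
  have hc : Jᶜ.card = 1 := by rw [Finset.card_compl, hJ, Fintype.card_fin]; omega
  obtain ⟨i, hi⟩ := Finset.card_eq_one.1 hc
  refine ⟨x, i, Subtype.ext ?_⟩
  have : J = Finset.univ.erase i := by
    rw [← compl_compl J, hi]; ext; simp
  simp [plaq, this]

/-- The plaquettes containing the `(d-2)`-facet orthogonal to two directions. -/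
lemma facet_subset_plaq_iff {x z : Fin d → ℤ} {i j k : Fin d} (hij : i ≠ j) :
    facet x ((Finset.univ.erase i).erase j) ⊆ (plaq z k).1 ↔
      (k = i ∧ (z = x ∨ z = x - unitVec j)) ∨ (k = j ∧ (z = x ∨ z = x - unitVec i)) := by
  constructor
  · intro h
    obtain ⟨h1, h2⟩ := facet_subset_facet h
    have hk : k = i ∨ k = j := by
      by_contra hk
      push Not at hk
      have := h1 (show k ∈ (Finset.univ.erase i).erase j by simp [hk])
      simp at this
    have main : ∀ a b : Fin d, a ≠ b → k = a →
        (∀ l, l ≠ a → l ≠ b → l ∈ (Finset.univ.erase i).erase j) → z = x ∨ z = x - unitVec b := by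
      intro a b hab hka hl
      have ha : z a = x a := by
        have := (h2 a).1
        simp [hka] at this
        exact this.symm
      have ho : ∀ l, l ≠ b → z l = x l := fun l hlb => by
        by_cases hla : l = a
        · rw [hla, ha]
        · exact ((h2 l).2 (hl l hla hlb)).symm
      rcases (h2 b).1 with hb | hb
      · left
        ext l
        by_cases hlb : l = b
        · rw [hlb, hb]
        · exact ho l hlb
      · right
        ext l
        by_cases hlb : l = b
        · subst hlb; simp [hb.1, unitVec_same]
        · simp [ho l hlb, unitVec_ne hlb]
    rcases hk with hk | hk
    · exact Or.inl ⟨hk, main i j hij hk fun l h1 h2 => by simp [h1, h2]⟩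
    · exact Or.inr ⟨hk, main j i hij.symm hk fun l h1 h2 => by simp [h1, h2]⟩
  · have main : ∀ a b : Fin d, a ≠ b → ∀ J : Finset (Fin d), a ∉ J → b ∉ J →
        facet x J ⊆ (plaq x a).1 ∧ facet x J ⊆ (plaq (x - unitVec b) a).1 := by
      intro a b hab J ha hb
      refine ⟨facet_mono x fun l hl => ?_, fun y hy l => ?_⟩
      · simp only [Finset.mem_erase, Finset.mem_univ, and_true]
        rintro rfl; exact ha hl
      · by_cases hlb : l = b
        · subst hlb
          right
          rcases hy l with h | h
          · simp [h, unitVec_same, hab.symm]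
          · exact absurd h.1 hb
        · rcases hy l with h | h
          · left; simp [h, unitVec_ne hlb]
          · right
            refine ⟨?_, by simp [h.2, unitVec_ne hlb]⟩
            simp only [Finset.mem_erase, Finset.mem_univ, and_true]
            rintro rfl; exact ha h.1
    rintro (⟨rfl, rfl | rfl⟩ | ⟨rfl, rfl | rfl⟩)
    · exact (main _ j hij _ (by simp) (by simp)).1
    · exact (main _ j hij _ (by simp) (by simp)).2
    · exact (main _ i hij.symm _ (by simp) (by simp)).1
    · exact (main _ i hij.symm _ (by simp) (by simp)).2

lemma exists_eq_facet_erase (hd : 2 ≤ d) {f : Set (Fin d → ℤ)} (hf : IsFacet (d - 2) f) :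
    ∃ x i j, i ≠ j ∧ f = facet x ((Finset.univ.erase i).erase j) := by
  obtain ⟨x, J, hJ, rfl⟩ := hf
  have hc : Jᶜ.card = 2 := by rw [Finset.card_compl, hJ, Fintype.card_fin]; omega
  obtain ⟨i, j, hij, h⟩ := Finset.card_eq_two.1 hc
  refine ⟨x, i, j, hij, congrArg _ ?_⟩
  rw [← compl_compl J, h]
  ext; simp [and_comm]

lemma isFacet_facet_erase {i j : Fin d} (hij : i ≠ j) (x : Fin d → ℤ) :
    IsFacet (d - 2) (facet x ((Finset.univ.erase i).erase j)) :=
  ⟨x, _, by rw [Finset.card_erase_of_mem (by simp [hij.symm]),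
    Finset.card_erase_of_mem (by simp)]; simp; omega, rfl⟩

/-! ### Exponential tails of bad clusters -/

open scoped ENNReal

/-- A vertex is bad if one of the edges `{v, v + unitVec i}` is closed. -/
def Bad (ω : Config d) (v : Fin d → ℤ) : Prop := ∃ i, ω (edge v i) = false

/-- The graph on the bad vertices, two of them being adjacent at sup-distance one. -/
def badGraph (ω : Config d) : SimpleGraph (Fin d → ℤ) where
  Adj u v := u ≠ v ∧ (∀ i, |v i - u i| ≤ 1) ∧ Bad ω u ∧ Bad ω v
  symm := ⟨fun _ _ h => ⟨h.1.symm, fun i => by rw [abs_sub_comm]; exact h.2.1 i, h.2.2.2, h.2.2.1⟩⟩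
  loopless := ⟨fun _ h => h.1 rfl⟩

/-- The bad cluster of `v` reaches a vertex at distance at least `n` from `v`. -/
def Far (ω : Config d) (v : Fin d → ℤ) (n : ℕ) : Prop :=
  ∃ w i, (badGraph ω).Reachable v w ∧ (n : ℤ) ≤ |w i - v i|

lemma percMeasure_closed (p : unitInterval) (T : Finset (Edge d)) :
    percMeasure d p {ω | ∀ e ∈ T, ω e = false} = ENNReal.ofReal (1 - p) ^ T.card := by
  have h : {ω : Config d | ∀ e ∈ T, ω e = false} = Set.pi (T : Set (Edge d)) fun _ => {false} := by
    ext; simp [Set.mem_pi]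
  rw [h, percMeasure, Measure.infinitePi_pi _ (fun _ _ => MeasurableSet.of_discrete)]
  rw [Finset.prod_congr rfl fun e _ => bernoulliMeasure_apply_of_notMem_of_mem p
    MeasurableSet.of_discrete (by simp) (by simp), Finset.prod_const]
  congr 1
  rw [ENNReal.ofReal]
  congr 1
  ext
  simp [p.2.2]

/-- The walk from `v` whose `j`-th displacement is `s j - 1`. -/
def walkPos {n : ℕ} (v : Fin d → ℤ) (s : Fin n → Fin d → Fin 3) (k : ℕ) : Fin d → ℤ :=
  v + ∑ j ∈ Finset.range k, fun i => if h : j < n then ((s ⟨j, h⟩ i : ℕ) : ℤ) - 1 else 0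

lemma exists_walkPos_eq {n : ℕ} (f : ℕ → Fin d → ℤ)
    (hf : ∀ k < n, ∀ i, |f (k + 1) i - f k i| ≤ 1) :
    ∃ s : Fin n → Fin d → Fin 3, ∀ k ≤ n, walkPos (f 0) s k = f k := by
  refine ⟨fun j i => ⟨(f (j + 1) i - f j i + 1).toNat, ?_⟩, fun k hk => ?_⟩
  · have := abs_le.1 (hf j j.2 i)
    omega
  · rw [walkPos, Finset.sum_congr rfl (g := fun j => f (j + 1) - f j), Finset.sum_range_sub]
    · abel
    · intro j hj
      ext i
      have hjn : j < n := (Finset.mem_range.1 hj).trans_le hk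
      have := abs_le.1 (hf j hjn i)
      simp only [hjn, dite_true, Pi.sub_apply]
      omega

/-- A coordinate changes by at most one per step, so a self-avoiding path to distance `n` has at
least `n` steps. Its first `n` vertices are distinct and bad; `t` selects a closed edge at each. -/
lemma Far.exists_walkPos {ω : Config d} {v : Fin d → ℤ} {n : ℕ} (h : Far ω v n) :
    ∃ (s : Fin n → Fin d → Fin 3) (t : Fin n → Fin d),
      (Function.Injective fun k : Fin n => walkPos v s k) ∧
        ∀ k : Fin n, ω (edge (walkPos v s k) (t k)) = false := by
  obtain ⟨w, i, hr, hi⟩ := h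
  obtain ⟨p, hp⟩ := hr.exists_isPath
  have hstep : ∀ k < p.length, (badGraph ω).Adj (p.getVert k) (p.getVert (k + 1)) :=
    fun k hk => p.adj_getVert_succ hk
  have hdist : ∀ k ≤ p.length, |p.getVert k i - v i| ≤ k := by
    intro k
    induction k with
    | zero => simp
    | succ k ih =>
      intro hk
      have h1 := ih (by omega)
      have h2 := (hstep k (by omega)).2.1 i
      rw [abs_le] at *
      push_cast
      omega
  have hn : n ≤ p.length := by
    have := hdist p.length le_rfl
    rw [p.getVert_length] at this
    omega
  obtain ⟨s, hs⟩ := exists_walkPos_eq (n := n) p.getVert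
    fun k hk => (hstep k (by omega)).2.1
  rw [p.getVert_zero] at hs
  have : Nonempty (Fin d) := ⟨i⟩
  choose! t ht using fun k (hk : k < p.length) => (hstep k hk).2.2.1
  refine ⟨s, fun k => t k, fun a b hab => ?_, fun k => ?_⟩
  · simp only [hs a a.2.le, hs b b.2.le] at hab
    exact Fin.ext (hp.getVert_injOn (by simp; omega) (by simp; omega) hab)
  · rw [hs k k.2.le]
    exact ht k (by omega)

/-- Union bound over `3 ^ d` displacements and `d` edge directions per step. Distinct vertices are
lower ends of distinct edges, so independence gives `(1 - p) ^ n` for each choice. -/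
lemma percMeasure_far_le (p : unitInterval) (v : Fin d → ℤ) (n : ℕ) :
    percMeasure d p {ω | Far ω v n} ≤ ((3 ^ d * d : ℕ) * ENNReal.ofReal (1 - p)) ^ n := by
  have hsub : {ω : Config d | Far ω v n} ⊆
      ⋃ st : (Fin n → Fin d → Fin 3) × (Fin n → Fin d),
        {ω | (Function.Injective fun k : Fin n => walkPos v st.1 k) ∧
          ∀ k : Fin n, ω (edge (walkPos v st.1 k) (st.2 k)) = false} := by
    intro ω hω
    obtain ⟨s, t, h⟩ := Far.exists_walkPos hω
    exact Set.mem_iUnion.2 ⟨(s, t), h⟩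
  refine (measure_mono hsub).trans ((measure_iUnion_fintype_le _ _).trans ?_)
  have hle : ∀ st : (Fin n → Fin d → Fin 3) × (Fin n → Fin d), percMeasure d p
      {ω | (Function.Injective fun k : Fin n => walkPos v st.1 k) ∧
          ∀ k : Fin n, ω (edge (walkPos v st.1 k) (st.2 k)) = false} ≤
      ENNReal.ofReal (1 - p) ^ n := by
    rintro ⟨s, t⟩
    by_cases hinj : Function.Injective fun k : Fin n => walkPos v s k
    · have hinj' : Function.Injective fun k : Fin n => edge (walkPos v s k) (t k) :=
        fun a b hab => hinj (edge_injective hab).1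
      refine (measure_mono fun ω hω => ?_).trans
        ((percMeasure_closed p (Finset.univ.map ⟨_, hinj'⟩)).trans (by simp)).le
      intro e he
      obtain ⟨k, -, rfl⟩ := Finset.mem_map.1 he
      exact hω.2 k
    · simp [hinj]
  refine (Finset.sum_le_sum fun st _ => hle st).trans (le_of_eq ?_)
  simp [mul_pow]

/-- Below this density of closed edges the bad clusters are subcritical. -/
lemma percMeasure_far_le_half (hd : 1 ≤ d) {p : unitInterval}
    (hp : 1 - 1 / (2 * (3 ^ d * d)) < (p : ℝ)) (v : Fin d → ℤ) (n : ℕ) :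
    percMeasure d p {ω | Far ω v n} ≤ 2⁻¹ ^ n := by
  refine (percMeasure_far_le p v n).trans (pow_le_pow_left' ?_ n)
  have hC : (0 : ℝ) < 3 ^ d * d := by positivity
  have h1 : (1 - p : ℝ) ≤ 1 / (2 * (3 ^ d * d)) := by linarith
  rw [← ENNReal.ofReal_natCast, ← ENNReal.ofReal_mul (by positivity)]
  have h2 : (2⁻¹ : ℝ≥0∞) = ENNReal.ofReal 2⁻¹ := by
    rw [ENNReal.ofReal_inv_of_pos two_pos]; simp
  rw [h2]
  apply ENNReal.ofReal_le_ofReal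
  push_cast
  calc (3 ^ d * d : ℝ) * (1 - p) ≤ 3 ^ d * d * (1 / (2 * (3 ^ d * d))) := by gcongr
    _ = 2⁻¹ := by field_simp

/-- Borel–Cantelli. Letting the base point depend on `n` covers both a fixed vertex, whose bad
cluster is then bounded, and a vertex moving away along an axis. -/
lemma ae_eventually_not_far (hd : 1 ≤ d) {p : unitInterval}
    (hp : 1 - 1 / (2 * (3 ^ d * d)) < (p : ℝ)) (v : ℕ → Fin d → ℤ) :
    ∀ᵐ ω ∂(percMeasure d p), ∀ᶠ n in Filter.atTop, ¬ Far ω (v n) n := by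
  refine ae_eventually_notMem (s := fun n => {ω | Far ω (v n) n}) (ne_top_of_le_ne_top ?_
    (ENNReal.tsum_le_tsum fun n => percMeasure_far_le_half hd hp (v n) n))
  rw [ENNReal.tsum_geometric]
  simp

/-! ### Cycles modulo two and their primitives -/

/-- Sets of plaquettes of the form `x, i ↦ S x i` with coefficients modulo two form a cycle. -/
def IsCycle (S : (Fin d → ℤ) → Fin d → ZMod 2) : Prop :=
  ∀ x i j, i ≠ j → S x i + S x j + S (x - unitVec j) i + S (x - unitVec i) j = 0

/-- A cycle modulo two that vanishes far away on every ray in direction `o` is the boundary of the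
set of cubes from which the ray crosses it an odd number of times. -/
lemma IsCycle.exists_primitive {S : (Fin d → ℤ) → Fin d → ZMod 2} (hS : IsCycle S) (o : Fin d)
    (hfin : ∀ c : Fin d → ℤ, ∃ N : ℕ, ∀ k ≥ N, ∀ i, S (c + k • unitVec o) i = 0) :
    ∃ D : (Fin d → ℤ) → ZMod 2, (∀ x i, S x i = D x + D (x - unitVec i)) ∧
      ∀ (c : Fin d → ℤ) (N : ℕ), (∀ k > N, S (c + k • unitVec o) o = 0) →
        D c = ∑ k ∈ Finset.range N, S (c + (k + 1) • unitVec o) o := by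
  choose N hN using hfin
  have hindep : ∀ (c : Fin d → ℤ) (M M' : ℕ), (∀ k > M, S (c + k • unitVec o) o = 0) → M ≤ M' →
      ∑ k ∈ Finset.range M, S (c + (k + 1) • unitVec o) o =
        ∑ k ∈ Finset.range M', S (c + (k + 1) • unitVec o) o := fun c M M' h hle =>
    Finset.sum_subset (Finset.range_mono hle) fun k _ hk =>
      h _ (by rw [Finset.mem_range] at hk; omega)
  -- The chosen cutoff `N c` is immaterial: any cutoff beyond the last crossing gives the same sum.
  have hD : ∀ (c : Fin d → ℤ) (M : ℕ), (∀ k > M, S (c + k • unitVec o) o = 0) →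
      ∑ k ∈ Finset.range (N c), S (c + (k + 1) • unitVec o) o =
        ∑ k ∈ Finset.range M, S (c + (k + 1) • unitVec o) o := fun c M h => by
    rw [hindep c (N c) (max (N c) M) (fun k hk => hN c k hk.le o) (le_max_left _ _),
      hindep c M (max (N c) M) h (le_max_right _ _)]
  refine ⟨fun c => ∑ k ∈ Finset.range (N c), S (c + (k + 1) • unitVec o) o, fun x i => ?_, hD⟩
  dsimp only
  by_cases hi : i = o
  · subst hi
    have hshift : ∀ k : ℕ, x - unitVec i + (k + 1) • unitVec i = x + k • unitVec i := fun k => by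
      rw [succ_nsmul]; abel
    -- The ray from `x - unitVec i` crosses one more plaquette, `plaq x i`, than the ray from `x`.
    rw [hD (x - unitVec i) (N x + 1)]
    · simp_rw [hshift]
      rw [Finset.sum_range_succ']
      simp only [zero_smul, add_zero]
      rw [← add_assoc, CharTwo.add_self_eq_zero, zero_add]
    · intro k hk
      obtain ⟨k, rfl⟩ := Nat.exists_eq_add_one_of_ne_zero (show k ≠ 0 by omega)
      rw [hshift]
      exact hN x k (by omega) i
  · set M := max (N x) (N (x - unitVec i))
    rw [hD x M fun k hk => hN x k (le_trans (le_max_left _ _) hk.le) o,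
      hD (x - unitVec i) M fun k hk => hN _ k (le_trans (le_max_right _ _) hk.le) o,
      ← Finset.sum_add_distrib]
    -- The cycle relation at a `(d-2)`-facet between the two parallel rays makes the difference of
    -- their crossing counts telescope.
    have hterm : ∀ k : ℕ, S (x + (k + 1) • unitVec o) o + S (x - unitVec i + (k + 1) • unitVec o) o =
        S (x + (k + 1) • unitVec o) i - S (x + k • unitVec o) i := fun k => by
      have h := hS (x + (k + 1) • unitVec o) o i (Ne.symm hi)
      have e1 : x + (k + 1) • unitVec o - unitVec i = x - unitVec i + (k + 1) • unitVec o := by abel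
      have e2 : x + (k + 1) • unitVec o - unitVec o = x + k • unitVec o := by
        rw [succ_nsmul]; abel
      rw [e1, e2] at h
      generalize S (x + (k + 1) • unitVec o) o = a at h ⊢
      generalize S (x + (k + 1) • unitVec o) i = b at h ⊢
      generalize S (x - unitVec i + (k + 1) • unitVec o) o = c at h ⊢
      generalize S (x + k • unitVec o) i = e at h ⊢
      revert a b c e
      decide
    simp_rw [hterm]
    rw [Finset.sum_range_sub (fun k => S (x + k • unitVec o) i),
      hN x M (le_max_left _ _) i]
    simp [CharTwo.neg_eq]

/-- Enclose the support of `S` in a box. Beyond it in a direction other than `o`, the ray misses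
`S`. Beyond it in direction `o`, a translation along `j` leaves the box sideways without crossing
`S`; this is where a second direction is needed. -/
lemma finite_support_primitive {o j : Fin d} (hj : j ≠ o) {S : (Fin d → ℤ) → Fin d → ZMod 2}
    {D : (Fin d → ℤ) → ZMod 2} (hSD : ∀ x i, S x i = D x + D (x - unitVec i))
    (hray : ∀ c : Fin d → ℤ, (∀ k : ℕ, S (c + k • unitVec o) o = 0) → D c = 0)
    (hfin : {x | ∃ i, S x i ≠ 0}.Finite) : {c | D c ≠ 0}.Finite := by
  obtain ⟨a, ha⟩ := hfin.bddBelow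
  obtain ⟨b, hb⟩ := hfin.bddAbove
  have hout : ∀ (x : Fin d → ℤ) (l : Fin d), x l < a l ∨ b l < x l → ∀ i, S x i = 0 := by
    intro x l hl i
    by_contra hne
    have h1 : a l ≤ x l := ha (show x ∈ {x | ∃ i, S x i ≠ 0} from ⟨i, hne⟩) l
    have h2 : x l ≤ b l := hb (show x ∈ {x | ∃ i, S x i ≠ 0} from ⟨i, hne⟩) l
    omega
  have hside : ∀ (c : Fin d → ℤ) (l : Fin d), l ≠ o → c l < a l ∨ b l < c l → D c = 0 :=
    fun c l hlo hl => hray c fun k => hout _ l (by simpa [unitVec_ne hlo] using hl) o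
  have hmain : ∀ (c : Fin d → ℤ) (l : Fin d), c l < a l ∨ b l < c l → D c = 0 := by
    intro c l hl
    by_cases hlo : l = o
    · subst hlo
      have hmove : ∀ n : ℕ, D (c + n • unitVec j) = D c := by
        intro n
        induction n with
        | zero => simp
        | succ n ih =>
          have h := hSD (c + (n + 1) • unitVec j) j
          rw [hout _ l (by simpa [unitVec_ne hj.symm] using hl)] at h
          have e : c + (n + 1) • unitVec j - unitVec j = c + n • unitVec j := by
            rw [succ_nsmul]; abel
          rw [e, ih, ← CharTwo.sub_eq_add, eq_comm, sub_eq_zero] at h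
          exact h
      rw [← hmove (b j - c j + 1).toNat]
      refine hside _ j hj (Or.inr ?_)
      rw [Pi.add_apply, Pi.smul_apply, unitVec_same, nsmul_eq_mul, mul_one]
      omega
    · exact hside c l hlo hl
  refine (Set.finite_Icc a b).subset fun c hc => ?_
  by_contra hnot
  apply hc
  by_contra hne
  refine hnot ⟨fun l => ?_, fun l => ?_⟩ <;>
  · by_contra hl
    rw [not_le] at hl
    exact hne (hmain c l (by tauto))

open Classical in
/-- The indicator function, modulo two, of a set of plaquettes. -/
noncomputable def plaqInd (P : Set (Plaquette d)) (x : Fin d → ℤ) (i : Fin d) : ZMod 2 :=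
  if plaq x i ∈ P then 1 else 0

lemma plaqInd_eq_zero_iff {P : Set (Plaquette d)} {x : Fin d → ℤ} {i : Fin d} :
    plaqInd P x i = 0 ↔ plaq x i ∉ P := by
  unfold plaqInd; split_ifs <;> simp_all

/-- Exactly four plaquettes contain a given `(d-2)`-facet, and the cycle relation is the parity of
those in `P`. -/
lemma plaquetteBoundary_eq_empty (hd : 2 ≤ d) {P : Set (Plaquette d)} (hP : IsCycle (plaqInd P)) :
    plaquetteBoundary P = ∅ := by
  classical
  refine Set.eq_empty_iff_forall_notMem.2 fun f hf => ?_
  obtain ⟨hf, hodd⟩ := hf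
  obtain ⟨x, i, j, hij, rfl⟩ := exists_eq_facet_erase hd hf
  have hset : {π | π ∈ P ∧ facet x ((Finset.univ.erase i).erase j) ⊆ π.1} =
      (({plaq x i, plaq x j, plaq (x - unitVec j) i, plaq (x - unitVec i) j} :
        Finset (Plaquette d)).filter (· ∈ P) : Finset (Plaquette d)) := by
    ext π
    obtain ⟨z, k, rfl⟩ := exists_eq_plaq (by omega) π
    simp only [Set.mem_ofPred_eq, Finset.coe_filter, Finset.mem_insert, Finset.mem_singleton,
      facet_subset_plaq_iff hij, plaq_eq_iff]
    tauto
  rw [hset, Set.ncard_coe_finset] at hodd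
  have hne : ∀ l : Fin d, x ≠ x - unitVec l := fun l h => by
    have := congrFun h l
    simp [unitVec_same] at this
    omega
  refine Nat.not_even_iff_odd.2 hodd ((ZMod.natCast_eq_zero_iff_even).1 ?_)
  rw [Finset.card_filter, Nat.cast_sum, Finset.sum_insert, Finset.sum_insert, Finset.sum_insert,
    Finset.sum_singleton, ← hP x i j hij]
  · simp [plaqInd, add_assoc]
  · simp [plaq_eq_iff, hij]
  · simp [plaq_eq_iff, hne, hij.symm]
  · simp [plaq_eq_iff, hne, hij]

/-! ### Components of the boundary of a set of cubes -/

/-- The plaquettes separating a cube of `K` from a cube outside `K`; a cube is represented by its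
lower corner. -/
def cubeBoundary (K : Set (Fin d → ℤ)) : Set (Plaquette d) :=
  {π | ∃ x i, π = plaq x i ∧ ¬ (x ∈ K ↔ x - unitVec i ∈ K)}

lemma plaq_mem_cubeBoundary {K : Set (Fin d → ℤ)} {x : Fin d → ℤ} {i : Fin d} :
    plaq x i ∈ cubeBoundary K ↔ ¬ (x ∈ K ↔ x - unitVec i ∈ K) := by
  constructor
  · rintro ⟨y, j, h, hK⟩
    obtain ⟨rfl, rfl⟩ := plaq_injective h
    exact hK
  · exact fun h => ⟨x, i, rfl, h⟩

open Classical in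
lemma plaqInd_cubeBoundary (K : Set (Fin d → ℤ)) (x : Fin d → ℤ) (i : Fin d) :
    plaqInd (cubeBoundary K) x i =
      (if x ∈ K then 1 else 0) + (if x - unitVec i ∈ K then 1 else 0) := by
  unfold plaqInd
  rw [if_congr plaq_mem_cubeBoundary rfl rfl]
  by_cases h1 : x ∈ K <;> by_cases h2 : x - unitVec i ∈ K <;> simp [h1, h2]
  decide

/-- Two plaquettes of `B` are adjacent if they share a `(d-2)`-facet. -/
def boundaryGraph (B : Set (Plaquette d)) : SimpleGraph (Plaquette d) where
  Adj π₁ π₂ := (plaquetteGraph d).Adj π₁ π₂ ∧ π₁ ∈ B ∧ π₂ ∈ B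
  symm := ⟨fun _ _ h => ⟨h.1.symm, h.2.2, h.2.1⟩⟩
  loopless := ⟨fun _ h => h.1.1 rfl⟩

/-- The part of a component of `boundaryGraph B` that lies in `B`. -/
def componentIn (B : Set (Plaquette d)) (C : (boundaryGraph B).ConnectedComponent) :
    Set (Plaquette d) := {π | π ∈ B ∧ (boundaryGraph B).connectedComponentMk π = C}

/-- Plaquettes outside `B` are isolated vertices of `boundaryGraph B`, so a component meeting `B`
lies inside it. -/
lemma componentIn_eq_supp {B : Set (Plaquette d)} {C : (boundaryGraph B).ConnectedComponent}
    (h : (componentIn B C).Nonempty) : componentIn B C = C.supp := by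
  obtain ⟨π₀, h₀, rfl⟩ := h
  ext π
  refine ⟨fun h => h.2, fun h => ⟨?_, h⟩⟩
  obtain ⟨p⟩ := SimpleGraph.ConnectedComponent.exact h
  cases p with
  | nil => exact h₀
  | cons h _ => exact h.2.1

lemma connected_componentIn {B : Set (Plaquette d)} {C : (boundaryGraph B).ConnectedComponent}
    (h : (componentIn B C).Nonempty) : ((plaquetteGraph d).induce (componentIn B C)).Connected := by
  rw [componentIn_eq_supp h]
  exact C.connected_toSimpleGraph.mono fun π₁ π₂ (h : (boundaryGraph B).Adj π₁ π₂) => h.1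

/-- Plaquettes of `B` around a common `(d-2)`-facet are mutually adjacent, so a component contains
all of them or none. -/
lemma isCycle_componentIn {B : Set (Plaquette d)} (hB : IsCycle (plaqInd B))
    (C : (boundaryGraph B).ConnectedComponent) : IsCycle (plaqInd (componentIn B C)) := by
  classical
  intro x i j hij
  set f := facet x ((Finset.univ.erase i).erase j) with hf
  have key : ∀ π π' : Plaquette d, f ⊆ π.1 → f ⊆ π'.1 → π ∈ componentIn B C → π' ∈ B →
      π' ∈ componentIn B C := by
    intro π π' h h' hπ hπ'
    refine ⟨hπ', ?_⟩
    by_cases hne : π' = π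
    · rw [hne]; exact hπ.2
    · rw [← hπ.2]
      exact SimpleGraph.ConnectedComponent.sound (SimpleGraph.Adj.reachable
        ⟨⟨hne, f, isFacet_facet_erase hij x, h', h⟩, hπ', hπ.1⟩)
  have h1 : f ⊆ (plaq x i).1 := by simp [hf, facet_subset_plaq_iff hij]
  have h2 : f ⊆ (plaq x j).1 := by simp [hf, facet_subset_plaq_iff hij]
  have h3 : f ⊆ (plaq (x - unitVec j) i).1 := by simp [hf, facet_subset_plaq_iff hij]
  have h4 : f ⊆ (plaq (x - unitVec i) j).1 := by simp [hf, facet_subset_plaq_iff hij]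
  by_cases hex : ∃ π ∈ componentIn B C, f ⊆ π.1
  · obtain ⟨π, hπ, hfπ⟩ := hex
    have heq : ∀ y l, f ⊆ (plaq y l).1 → plaqInd (componentIn B C) y l = plaqInd B y l :=
      fun y l hyl => if_congr ⟨fun h => h.1, fun h => key π _ hfπ hyl hπ h⟩ rfl rfl
    rw [heq _ _ h1, heq _ _ h2, heq _ _ h3, heq _ _ h4]
    exact hB x i j hij
  · have heq : ∀ y l, f ⊆ (plaq y l).1 → plaqInd (componentIn B C) y l = 0 :=
      fun y l hyl => plaqInd_eq_zero_iff.2 fun h => hex ⟨_, h, hyl⟩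
    rw [heq _ _ h1, heq _ _ h2, heq _ _ h3, heq _ _ h4]
    simp

/-- Some component of the boundary of `K` surrounds a given cube of `K`. -/
lemma exists_surface_cubeBoundary (hd : 2 ≤ d) {K : Set (Fin d → ℤ)} (o : Fin d)
    (hK : ∀ c : Fin d → ℤ, ∃ N : ℕ, ∀ k ≥ N, c + k • unitVec o ∉ K) {c₀ : Fin d → ℤ} (hc₀ : c₀ ∈ K) :
    ∃ (S : Set (Plaquette d)) (D : (Fin d → ℤ) → ZMod 2), S ⊆ cubeBoundary K ∧ IsSurface S ∧
      (∀ x i, plaqInd S x i = D x + D (x - unitVec i)) ∧ D c₀ ≠ 0 ∧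
      ∀ c : Fin d → ℤ, (∀ k : ℕ, plaqInd S (c + k • unitVec o) o = 0) → D c = 0 := by
  classical
  set B := cubeBoundary K with hBdef
  have hB : IsCycle (plaqInd B) := by
    intro x i j _
    simp only [hBdef, plaqInd_cubeBoundary]
    rw [sub_right_comm x (unitVec j) (unitVec i)]
    generalize (if x ∈ K then (1 : ZMod 2) else 0) = a
    generalize (if x - unitVec i ∈ K then (1 : ZMod 2) else 0) = b
    generalize (if x - unitVec j ∈ K then (1 : ZMod 2) else 0) = c
    generalize (if x - unitVec i - unitVec j ∈ K then (1 : ZMod 2) else 0) = e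
    revert a b c e
    decide
  have hfinB : ∀ c : Fin d → ℤ, ∃ N : ℕ, ∀ k ≥ N, ∀ i, plaq (c + k • unitVec o) i ∉ B := by
    intro c
    obtain ⟨N, hN⟩ := hK c
    choose N' hN' using fun i => hK (c - unitVec i)
    refine ⟨N + ∑ i, N' i, fun k hk i => ?_⟩
    rw [hBdef, plaq_mem_cubeBoundary, not_not]
    have h1 := Finset.single_le_sum (f := N') (fun _ _ => Nat.zero_le _) (Finset.mem_univ i)
    have h2 := hN' i k (by omega)
    rw [← add_sub_right_comm] at h2
    exact iff_of_false (hN k (by omega)) h2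
  have hfin : ∀ (C : (boundaryGraph B).ConnectedComponent) (c : Fin d → ℤ), ∃ N : ℕ, ∀ k ≥ N, ∀ i,
      plaqInd (componentIn B C) (c + k • unitVec o) i = 0 := fun C c =>
    (hfinB c).imp fun N hN k hk i => plaqInd_eq_zero_iff.2 fun h => hN k hk i h.1
  choose D hD hDsum using fun C => (isCycle_componentIn hB C).exists_primitive o (hfin C)
  -- The ray from `c₀` starts in `K` and ends outside, so it crosses `B` an odd number of times.
  -- Split by components, some component is crossed an odd number of times.
  obtain ⟨C, hC⟩ : ∃ C, D C c₀ ≠ 0 := by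
    by_contra hall
    push Not at hall
    obtain ⟨N, hN⟩ := hfinB c₀
    obtain ⟨N', hN'⟩ := hK c₀
    set M := max N N'
    have hsum : ∑ k ∈ Finset.range M, plaqInd B (c₀ + (k + 1) • unitVec o) o = 1 := by
      have hterm : ∀ k : ℕ, plaqInd B (c₀ + (k + 1) • unitVec o) o =
          (if c₀ + (k + 1) • unitVec o ∈ K then 1 else 0) -
            (if c₀ + k • unitVec o ∈ K then 1 else 0) := fun k => by
        have e : c₀ + (k + 1) • unitVec o - unitVec o = c₀ + k • unitVec o := by
          rw [succ_nsmul]; abel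
        rw [hBdef, plaqInd_cubeBoundary, e, CharTwo.sub_eq_add]
      simp_rw [hterm]
      rw [Finset.sum_range_sub (fun k : ℕ => if c₀ + k • unitVec o ∈ K then (1 : ZMod 2) else 0),
        if_neg (hN' M (le_max_right _ _))]
      simp [hc₀, CharTwo.neg_eq]
    set m : ℕ → (boundaryGraph B).ConnectedComponent :=
      fun k => (boundaryGraph B).connectedComponentMk (plaq (c₀ + (k + 1) • unitVec o) o)
    have hsplit : ∀ k ∈ Finset.range M, plaqInd B (c₀ + (k + 1) • unitVec o) o =
        ∑ C ∈ (Finset.range M).image m, plaqInd (componentIn B C) (c₀ + (k + 1) • unitVec o) o := by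
      intro k hk
      rw [Finset.sum_eq_single (m k)]
      · exact if_congr ⟨fun h => ⟨h, rfl⟩, fun h => h.1⟩ rfl rfl
      · exact fun C _ hne => plaqInd_eq_zero_iff.2 fun h => hne h.2.symm
      · exact fun h => absurd (Finset.mem_image_of_mem m hk) h
    rw [Finset.sum_congr rfl hsplit, Finset.sum_comm, Finset.sum_eq_zero] at hsum
    · exact zero_ne_one hsum
    · intro C _
      rw [← hDsum C c₀ M, hall C]
      exact fun k hk => plaqInd_eq_zero_iff.2 fun h =>
        hN k ((le_max_left _ _).trans hk.le) o h.1
  have hray : ∀ c : Fin d → ℤ,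
      (∀ k : ℕ, plaqInd (componentIn B C) (c + k • unitVec o) o = 0) → D C c = 0 := fun c hc => by
    rw [hDsum C c 0 fun k _ => hc k]; simp
  refine ⟨componentIn B C, D C, fun π h => h.1, ⟨connected_componentIn ?_,
    plaquetteBoundary_eq_empty hd (isCycle_componentIn hB C)⟩, hD C, hC, hray⟩
  -- An empty set of plaquettes would have zero primitive, contradicting `D C c₀ ≠ 0`.
  by_contra hempty
  rw [Set.not_nonempty_iff_eq_empty] at hempty
  exact hC (hray c₀ fun k => plaqInd_eq_zero_iff.2 (by simp [hempty]))

/-! ### Hulls of bad clusters and good surfaces -/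

/-- The cubes of `A`, together with all cubes that meet a bad cluster meeting a cube of `A`. -/
def cubeHull (ω : Config d) (A : Set (Fin d → ℤ)) : Set (Fin d → ℤ) :=
  {c | c ∈ A ∨ ∃ w ∈ facet c Finset.univ, ∃ u, (∃ a ∈ A, u ∈ facet a Finset.univ) ∧
    Bad ω w ∧ Bad ω u ∧ (badGraph ω).Reachable u w}

/-- Vertices of one cube are at sup-distance at most one, so a bad vertex of a hull cube belongs to
a bad cluster already absorbed, or itself touches `A`. -/
lemma mem_cubeHull_of_bad {ω : Config d} {A : Set (Fin d → ℤ)} {c c' v : Fin d → ℤ}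
    (hc : c ∈ cubeHull ω A) (hv : v ∈ facet c Finset.univ) (hv' : v ∈ facet c' Finset.univ)
    (hbad : Bad ω v) : c' ∈ cubeHull ω A := by
  rcases hc with hc | ⟨w, hw, u, hu, hbw, hbu, hr⟩
  · exact Or.inr ⟨v, hv', v, ⟨c, hc, hv⟩, hbad, hbad, SimpleGraph.Reachable.refl _⟩
  · refine Or.inr ⟨v, hv', u, hu, hbad, hbu, hr.trans ?_⟩
    by_cases hne : w = v
    · rw [hne]
    · refine SimpleGraph.Adj.reachable (G := badGraph ω) ⟨hne, fun i => ?_, hbw, hbad⟩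
      have := hw i
      have := hv i
      rw [abs_le]
      omega

lemma not_bad_of_mem_cubeBoundary {ω : Config d} {A : Set (Fin d → ℤ)} {π : Plaquette d}
    (hπ : π ∈ cubeBoundary (cubeHull ω A)) {v : Fin d → ℤ} (hv : v ∈ π.1) : ¬ Bad ω v := by
  obtain ⟨x, i, rfl, hK⟩ := hπ
  intro hbad
  have h1 : v ∈ facet x Finset.univ := facet_mono x (Finset.subset_univ _) hv
  have h2 : v ∈ facet (x - unitVec i) Finset.univ := by
    intro j
    by_cases hj : j = i
    · subst hj
      right
      have := hv j
      simp at this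
      simp [this, unitVec_same]
    · simpa [unitVec_ne hj] using h1 j
  exact hK ⟨fun h => mem_cubeHull_of_bad h h1 h2 hbad, fun h => mem_cubeHull_of_bad h h2 h1 hbad⟩

/-- The lower endpoint of an edge of the plaquette is not bad, so that edge is open. -/
lemma isGood_of_mem_cubeBoundary {ω : Config d} {A : Set (Fin d → ℤ)} {π : Plaquette d}
    (hπ : π ∈ cubeBoundary (cubeHull ω A)) : IsGood ω π := by
  intro e he
  obtain ⟨y, i, rfl⟩ := exists_eq_edge e
  have := not_bad_of_mem_cubeBoundary hπ (he (self_mem_facet y {i}))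
  simp only [Bad, not_exists, Bool.not_eq_false] at this
  exact this i

lemma IsGood.reachable {ω : Config d} {π : Plaquette d} (h : IsGood ω π) {y z : Fin d → ℤ}
    (hy : y ∈ π.1) (hz : z ∈ π.1) : (openGraph ω).Reachable y z := by
  obtain ⟨π, x, J, hJ, rfl⟩ := π
  have main : ∀ y ∈ facet x J, (openGraph ω).Reachable x y := by
    intro y hy
    -- Change the coordinates one at a time; every intermediate point stays in the facet.
    have key : ∀ T : Finset (Fin d), (fun j => if j ∈ T then y j else x j) ∈ facet x J ∧
        (openGraph ω).Reachable x (fun j => if j ∈ T then y j else x j) := by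
      intro T
      refine ⟨fun j => ?_, ?_⟩
      · by_cases hj : j ∈ T
        · simpa [hj] using hy j
        · simp [hj]
      induction T using Finset.induction_on with
      | empty => simp
      | insert i T hi ih =>
        set z : Fin d → ℤ := fun j => if j ∈ T then y j else x j with hz
        have hzi : z i = x i := by simp [hz, hi]
        have hzJ : z ∈ facet x J := fun j => by
          by_cases hj : j ∈ T
          · simpa [hz, hj] using hy j
          · simp [hz, hj]
        rcases hy i with hyi | ⟨hiJ, hyi⟩
        · convert ih using 1
          ext j
          by_cases hj : j = i
          · subst hj; simp [hyi, hz, hi]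
          · simp [hj, hz]
        · have e : (fun j => if j ∈ insert i T then y j else x j) = z + unitVec i := by
            ext j
            by_cases hj : j = i
            · subst hj; simp [hyi, hzi, unitVec_same]
            · simp [hj, hz, unitVec_ne hj]
          rw [e]
          refine ih.trans (openGraph_adj_add (h (edge z i) ?_)).reachable
          change facet z {i} ⊆ facet x J
          rw [facet_singleton]
          rintro _ (rfl | rfl)
          · exact hzJ
          · exact add_unitVec_mem_facet hiJ hzJ hzi
    simpa using (key Finset.univ).2
  exact (main y hy).symm.trans (main z hz)

/-- All vertices of a connected set of good plaquettes lie in the same open cluster. -/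
lemma IsSurface.reachable {ω : Config d} {S : Set (Plaquette d)} (hS : IsSurface S)
    (hgood : ∀ π ∈ S, IsGood ω π) {π π' : Plaquette d} (hπ : π ∈ S) (hπ' : π' ∈ S)
    {y z : Fin d → ℤ} (hy : y ∈ π.1) (hz : z ∈ π'.1) : (openGraph ω).Reachable y z := by
  obtain ⟨p⟩ := hS.1.preconnected ⟨π, hπ⟩ ⟨π', hπ'⟩
  have main : ∀ (a b : S), ((plaquetteGraph d).induce S).Walk a b → ∀ y ∈ a.1.1, ∀ z ∈ b.1.1,
      (openGraph ω).Reachable y z := by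
    intro a b p
    induction p with
    | nil => exact fun y hy z hz => (hgood _ (Subtype.prop _)).reachable hy hz
    | cons h p ih =>
      intro y hy z hz
      obtain ⟨-, f, ⟨q, J, -, rfl⟩, hf, hf'⟩ := h
      exact ((hgood _ (Subtype.prop _)).reachable hy (hf (self_mem_facet q J))).trans
        (ih q (hf' (self_mem_facet q J)) z hz)
  exact main _ _ p y hy z hz

/-- The function `D` does not change along edges that avoid all the plaquettes of `S`. -/
lemma primitive_eq_of_adj {S : Set (Plaquette d)} {D : (Fin d → ℤ) → ZMod 2}
    (hSD : ∀ x i, plaqInd S x i = D x + D (x - unitVec i)) {A : Set (Fin d → ℤ)}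
    (hA : ∀ x i, x ∈ A → x - unitVec i ∈ A → plaq x i ∉ S) {v w : Fin d → ℤ}
    (hvw : (lattice d).Adj v w) (hv : v ∈ A) (hw : w ∈ A) : D v = D w := by
  have key : ∀ x i, x ∈ A → x - unitVec i ∈ A → D x = D (x - unitVec i) := by
    intro x i hx hx'
    have h := hSD x i
    rwa [plaqInd_eq_zero_iff.2 (hA x i hx hx'), ← CharTwo.sub_eq_add, eq_comm, sub_eq_zero] at h
  obtain ⟨i, rfl | rfl⟩ := lattice_adj_iff.1 hvw
  · simpa using (key _ i hw (by simpa using hv)).symm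
  · simpa using key _ i hv (by simpa using hw)

lemma eq_of_walk {V α : Type*} {G : SimpleGraph V} {A : Set V}
    {D : V → α} (hG : ∀ v w, G.Adj v w → v ∈ A → w ∈ A → D v = D w)
    {v w : V} (p : G.Walk v w) (hp : ∀ u ∈ p.support, u ∈ A) : D v = D w := by
  induction p with
  | nil => rfl
  | cons h p ih =>
    rw [SimpleGraph.Walk.support_cons] at hp
    rw [hG _ _ h (hp _ (by simp)) (hp _ (by simp)), ih fun u hu => hp u (by simp [hu])]

lemma cubeBoundary_finite {K : Set (Fin d → ℤ)} (hK : K.Finite) : (cubeBoundary K).Finite := by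
  refine (Set.finite_iUnion fun i : Fin d =>
    ((hK.union (hK.image (· + unitVec i))).image (plaq · i))).subset ?_
  rintro _ ⟨x, i, rfl, h⟩
  refine Set.mem_iUnion.2 ⟨i, x, ?_, rfl⟩
  by_cases hx : x ∈ K
  · exact Or.inl hx
  · exact Or.inr ⟨x - unitVec i, by tauto, by simp⟩

lemma plaqInd_support_finite {S : Set (Plaquette d)} (hS : S.Finite) :
    {x | ∃ i, plaqInd S x i ≠ 0}.Finite := by
  refine (Set.finite_iUnion fun i : Fin d => hS.preimage (f := fun x => plaq x i)
    fun x _ y _ h => (plaq_injective h).1).subset ?_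
  rintro x ⟨i, hi⟩
  exact Set.mem_iUnion.2 ⟨i, by simpa [plaqInd_eq_zero_iff] using hi⟩

lemma cubeHull_finite {ω : Config d} (hω : ∀ v, ∃ n, ¬ Far ω v n) {A : Set (Fin d → ℤ)}
    (hA : A.Finite) : (cubeHull ω A).Finite := by
  choose n hn using hω
  have hU : (⋃ a ∈ A, facet a Finset.univ).Finite := hA.biUnion fun a _ => facet_finite a _
  refine (hA.union (hU.biUnion fun u _ =>
    Set.finite_Icc (u - fun _ => (n u : ℤ) + 1) (u + fun _ => (n u : ℤ) + 1))).subset ?_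
  rintro c (hc | ⟨w, hw, u, ⟨a, ha, hua⟩, -, -, hr⟩)
  · exact Or.inl hc
  · refine Or.inr (Set.mem_iUnion₂.2 ⟨u, Set.mem_iUnion₂.2 ⟨a, ha, hua⟩, ?_⟩)
    have hdist : ∀ i, |w i - u i| < n u := fun i => by
      by_contra h
      exact hn u ⟨w, i, hr, not_lt.1 h⟩
    constructor <;> intro i <;>
    · have h1 := abs_lt.1 (hdist i)
      have h2 := hw i
      simp only [Pi.add_apply, Pi.sub_apply]
      omega

/-- If all bad clusters are finite, any two vertices are surrounded by a finite surface of good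
plaquettes; the vertices inside the surface are those where the function `D` does not vanish. -/
lemma exists_finite_surface (hd : 2 ≤ d) {ω : Config d} (hω : ∀ v, ∃ n, ¬ Far ω v n)
    (x z : Fin d → ℤ) : ∃ (S : Set (Plaquette d)) (D : (Fin d → ℤ) → ZMod 2), S.Finite ∧
      IsSurface S ∧ (∀ π ∈ S, IsGood ω π) ∧ D x ≠ 0 ∧ D z ≠ 0 ∧ {c | D c ≠ 0}.Finite ∧
      ∀ v w, (lattice d).Adj v w → (∀ π ∈ S, v ∉ π.1) → (∀ π ∈ S, w ∉ π.1) → D v = D w := by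
  obtain ⟨p⟩ := lattice_reachable x z
  set A : Set (Fin d → ℤ) := {u | u ∈ p.support}
  have hA : A.Finite := p.support.finite_toSet
  have hK := cubeHull_finite hω hA
  have hinj : ∀ (c : Fin d → ℤ) (o : Fin d), Function.Injective fun k : ℕ => c + k • unitVec o :=
    fun c o k l h => by simpa [unitVec_same] using congrFun h o
  let o : Fin d := ⟨0, by omega⟩
  have hev : ∀ c : Fin d → ℤ, ∃ N : ℕ, ∀ k ≥ N, c + k • unitVec o ∉ cubeHull ω A := by
    intro c
    obtain ⟨N, hN⟩ := (hK.preimage (f := fun k : ℕ => c + k • unitVec o)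
      (hinj c o).injOn).bddAbove
    exact ⟨N + 1, fun k hk hmem => absurd (hN hmem) (by omega)⟩
  obtain ⟨S, D, hSB, hS, hSD, hDx, hray⟩ :=
    exists_surface_cubeBoundary hd o hev (c₀ := x) (Or.inl p.start_mem_support)
  have hSfin : S.Finite := (cubeBoundary_finite hK).subset hSB
  -- All cubes indexed by the path lie in the hull, so no boundary plaquette separates consecutive
  -- ones.
  have hwalk : D x = D z := eq_of_walk (A := A)
    (fun v w h hv hw => primitive_eq_of_adj hSD (fun y i hy hy' hmem =>
      plaq_mem_cubeBoundary.1 (hSB hmem) (iff_of_true (Or.inl hy) (Or.inl hy'))) h hv hw)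
    p fun u hu => hu
  refine ⟨S, D, hSfin, hS, fun π hπ => isGood_of_mem_cubeBoundary (hSB hπ), hDx, hwalk ▸ hDx,
    finite_support_primitive (o := o) (j := ⟨1, by omega⟩) (by simp [o]) hSD hray
      (plaqInd_support_finite hSfin), fun v w hvw hv hw => ?_⟩
  -- The plaquette between the cubes `y - unitVec i` and `y` contains the vertex `y`, so avoiding
  -- the vertices of `S` prevents crossing it.
  exact primitive_eq_of_adj hSD (A := {u | ∀ π ∈ S, u ∉ π.1})
    (fun y i hy _ hmem => hy _ hmem (self_mem_facet _ _)) hvw hv hw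

/-! ### Existence and uniqueness of the infinite cluster -/

/-- Surround a whole half-line in direction `j`. Its hull is infinite but meets every ray in the
transverse direction `o` in a bounded set, so crossing counts still make sense. -/
lemma exists_infinite_cluster {ω : Config d} {o j : Fin d} (hj : j ≠ o)
    (hω : ∀ a : Fin d → ℤ, ∀ᶠ n : ℕ in Filter.atTop, ¬ Far ω (a + n • unitVec o) n) :
    ∃ I : (openGraph ω).ConnectedComponent, I.supp.Infinite := by
  have hd : 2 ≤ d := by
    have := o.2
    have := j.2
    by_contra h
    exact hj (Fin.ext (by omega))
  set A : Set (Fin d → ℤ) := Set.range fun n : ℕ => n • unitVec j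
  have hinj : Function.Injective fun n : ℕ => n • unitVec j :=
    fun k l h => by simpa [unitVec_same] using congrFun h j
  have hev : ∀ c : Fin d → ℤ, ∃ N : ℕ, ∀ k ≥ N, c + k • unitVec o ∉ cubeHull ω A := by
    intro c
    -- The offset `r` places the cube at height at least `n + 2` above the hyperplane containing
    -- `A`. A bad cluster joining one of its vertices to a cube of `A`, of height at most 1, then
    -- has extent at least `n`. The finitely many `shift T` enumerate the corners of a cube.
    set r := (c o).natAbs + 2
    set shift : Finset (Fin d) → Fin d → ℤ := fun T i => if i ∈ T then 1 else 0 with hshift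
    obtain ⟨N, hN⟩ := Filter.eventually_atTop.1 (Filter.eventually_all.2
      fun T => hω (c + shift T + r • unitVec o))
    refine ⟨N + r, fun k hk hmem => ?_⟩
    obtain ⟨n, rfl⟩ : ∃ n, k = n + r := ⟨k - r, by omega⟩
    have hAo : ∀ a ∈ A, a o = 0 := by
      rintro _ ⟨m, rfl⟩
      simp [unitVec_ne hj.symm]
    have hsmul : ∀ (m : ℕ) i, (m • unitVec o) i = m * unitVec o i := fun m i => by
      rw [Pi.smul_apply, nsmul_eq_mul]
    have hco : (c + (n + r) • unitVec o) o = c o + n + r := by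
      simp [unitVec_same]; ring
    rcases hmem with hmem | ⟨w, hw, u, ⟨a, ha, hua⟩, -, -, hreach⟩
    · have := hAo _ hmem
      omega
    · have hwT : w = c + shift (Finset.univ.filter fun i => w i ≠ (c + (n + r) • unitVec o) i) +
          r • unitVec o + n • unitVec o := by
        ext i
        have := hw i
        by_cases hi : w i = (c + (n + r) • unitVec o) i
        · simp only [hshift, Pi.add_apply, Finset.mem_filter, Finset.mem_univ, true_and, hi, ne_eq,
            not_true_eq_false, if_false, hsmul]
          push_cast; ring
        · have hi' := (this.resolve_left hi).2
          simp only [hshift, Pi.add_apply, Finset.mem_filter, Finset.mem_univ, true_and, hi', ne_eq,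
            hsmul]
          rw [if_pos (by omega)]
          push_cast; ring
      have hnot := hN n (by omega) (Finset.univ.filter fun i => w i ≠ (c + (n + r) • unitVec o) i)
      rw [← hwT] at hnot
      refine hnot ⟨u, o, hreach.symm, ?_⟩
      have h1 := hw o
      have h2 := hua o
      rw [hAo a ha] at h2
      rw [hco] at h1
      rw [le_abs]
      omega
  obtain ⟨S, D, hSB, hS, hSD, hD0, hray⟩ :=
    exists_surface_cubeBoundary hd o hev (c₀ := 0) (Or.inl ⟨0, by simp⟩)
  have hgood : ∀ π ∈ S, IsGood ω π := fun π hπ => isGood_of_mem_cubeBoundary (hSB hπ)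
  have hDA : ∀ n : ℕ, D (n • unitVec j) = D 0 := by
    intro n
    induction n with
    | zero => simp
    | succ n ih =>
      rw [← ih]
      refine (primitive_eq_of_adj hSD (A := A) (fun y i hy hy' hmem =>
        plaq_mem_cubeBoundary.1 (hSB hmem) (iff_of_true (Or.inl hy) (Or.inl hy')))
        ?_ ⟨n, rfl⟩ ⟨n + 1, rfl⟩).symm
      dsimp only
      rw [succ_nsmul]
      exact lattice_adj_add _ j
  -- `D` is nonzero along the whole half-line, whereas a finite surface would enclose only finitely
  -- many cubes.
  have hSinf : S.Infinite := fun hfin => Set.infinite_of_injective_forall_mem hinj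
    (fun n => show _ ∈ {c | D c ≠ 0} by rw [Set.mem_ofPred_eq, hDA]; exact hD0)
    (finite_support_primitive hj hSD hray (plaqInd_support_finite hfin))
  obtain ⟨π₀, hπ₀⟩ := hSinf.nonempty
  obtain ⟨y, hy⟩ : π₀.1.Nonempty := by
    obtain ⟨_, x, J, -, rfl⟩ := π₀
    exact ⟨x, self_mem_facet x J⟩
  refine ⟨(openGraph ω).connectedComponentMk y, fun hfin => hSinf ?_⟩
  refine (hfin.finite_subsets.preimage (f := fun π : Plaquette d => π.1)
    Subtype.val_injective.injOn).subset fun π hπ z hz => ?_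
  exact SimpleGraph.ConnectedComponent.sound (hS.reachable hgood hπ hπ₀ hz hy)

/-- The deterministic part of the theorem. -/
lemma exists_unique_cluster_of_not_far {ω : Config d} {o j : Fin d} (hj : j ≠ o)
    (h₁ : ∀ v, ∃ n, ¬ Far ω v n)
    (h₂ : ∀ a : Fin d → ℤ, ∀ᶠ n : ℕ in Filter.atTop, ¬ Far ω (a + n • unitVec o) n) :
    (∃ I : (openGraph ω).ConnectedComponent, (I.supp.Infinite ∧
      ∀ I' : (openGraph ω).ConnectedComponent, I'.supp.Infinite → I' = I) ∧
      ∀ x : Fin d → ℤ, ∃ S : Set (Plaquette d), S.Finite ∧ IsSurface S ∧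
        SeparatesFromInfinity S {x} ∧ (∀ π ∈ S, IsGood ω π) ∧ ∀ π ∈ S, ∀ y ∈ π.1, y ∈ I.supp) ∧
      ω ∉ infiniteComponentEvent d := by
  have hd : 2 ≤ d := by
    have := o.2
    have := j.2
    by_contra h
    exact hj (Fin.ext (by omega))
  -- `D` is constant along a cluster avoiding the vertices of `S`, so a cluster starting inside
  -- would be trapped in the finite support of `D`.
  have hcross : ∀ (S : Set (Plaquette d)) (D : (Fin d → ℤ) → ZMod 2), {c | D c ≠ 0}.Finite →
      (∀ v w, (lattice d).Adj v w → (∀ π ∈ S, v ∉ π.1) → (∀ π ∈ S, w ∉ π.1) → D v = D w) →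
      ∀ (I : (openGraph ω).ConnectedComponent) (x : Fin d → ℤ), I.supp.Infinite → x ∈ I.supp →
        D x ≠ 0 → ∃ π ∈ S, ∃ y ∈ π.1, y ∈ I.supp := by
    intro S D hfin hD I x hI hx hDx
    by_contra hnot
    push Not at hnot
    refine hI (hfin.subset fun y hy => ?_)
    obtain ⟨p⟩ := SimpleGraph.ConnectedComponent.exact (hx.trans hy.symm)
    have : D x = D y := eq_of_walk (A := I.supp)
      (fun v w h hv hw => hD v w (openGraph_le_lattice ω h) (fun π hπ hvπ => hnot π hπ v hvπ hv)
        fun π hπ hwπ => hnot π hπ w hwπ hw) p fun u hu =>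
        (SimpleGraph.ConnectedComponent.sound ⟨(p.takeUntil u hu).reverse⟩).trans hx
    rwa [Set.mem_ofPred_eq, ← this]
  obtain ⟨I, hI⟩ := exists_infinite_cluster hj h₂
  obtain ⟨z, hz⟩ := hI.nonempty
  have hsurf : ∀ x : Fin d → ℤ, ∃ (S : Set (Plaquette d)) (D : (Fin d → ℤ) → ZMod 2), S.Finite ∧
      IsSurface S ∧ (∀ π ∈ S, IsGood ω π) ∧ D x ≠ 0 ∧ {c | D c ≠ 0}.Finite ∧
      (∀ v w, (lattice d).Adj v w → (∀ π ∈ S, v ∉ π.1) → (∀ π ∈ S, w ∉ π.1) → D v = D w) ∧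
      ∀ π ∈ S, ∀ y ∈ π.1, y ∈ I.supp := by
    intro x
    obtain ⟨S, D, hSfin, hS, hgood, hDx, hDz, hDfin, hD⟩ := exists_finite_surface hd h₁ x z
    obtain ⟨π₀, hπ₀, y₀, hy₀, hyI⟩ := hcross S D hDfin hD I z hI hz hDz
    exact ⟨S, D, hSfin, hS, hgood, hDx, hDfin, hD, fun π hπ y hy =>
      (SimpleGraph.ConnectedComponent.sound (hS.reachable hgood hπ hπ₀ hy hy₀)).trans hyI⟩
  refine ⟨⟨I, ⟨hI, fun I' hI' => ?_⟩, fun x => ?_⟩, ?_⟩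
  · obtain ⟨x, hx⟩ := hI'.nonempty
    obtain ⟨S, D, -, -, -, hDx, hDfin, hD, hSI⟩ := hsurf x
    obtain ⟨π, hπ, y, hy, hyI⟩ := hcross S D hDfin hD I' x hI' hx hDx
    exact hyI.symm.trans (hSI π hπ y hy)
  · obtain ⟨S, D, hSfin, hS, hgood, hDx, hDfin, hD, hSI⟩ := hsurf x
    refine ⟨S, hSfin, hS, fun v hv hv0 => ?_, hgood, hSI⟩
    by_contra hnot
    push Not at hnot
    refine Set.infinite_of_injective_forall_mem hv.1 (fun n => ?_) hDfin
    rw [Set.mem_ofPred_eq]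
    induction n with
    | zero => rw [hv0]; exact hDx
    | succ n ih => rwa [← hD _ _ (hv.2 n) (hnot n) (hnot (n + 1))]
  · rintro ⟨C, hC⟩
    obtain ⟨x, hx⟩ := hC.nonempty
    obtain ⟨S, D, -, -, -, hDx, hDfin, hD, hSI⟩ := hsurf x
    -- Vertices of `S` lie in the infinite cluster `I`, hence not in `X`.
    have havoid : ∀ v ∈ finiteClusterSet ω, ∀ π ∈ S, v ∉ π.1 := fun v hv π hπ hvπ => hI (by
      rw [← show (openGraph ω).connectedComponentMk v = I from hSI π hπ v hvπ]
      exact hv)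
    refine hC (Set.Finite.of_finite_image (f := Subtype.val) (hDfin.subset ?_)
      Subtype.val_injective.injOn)
    rintro _ ⟨y, hy, rfl⟩
    obtain ⟨p⟩ := SimpleGraph.ConnectedComponent.exact (hx.trans hy.symm)
    have : D x = D y := eq_of_walk (A := Set.univ) (D := fun v : finiteClusterSet ω => D v)
      (fun v w h _ _ => hD v w h (havoid v v.2) (havoid w w.2)) p fun _ _ => Set.mem_univ _
    rwa [Set.mem_ofPred_eq, ← this]

/-- The almost sure part of the theorem. -/
lemma ae_exists_unique_cluster (hd : 2 ≤ d) {p : unitInterval}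
    (hp : 1 - 1 / (2 * (3 ^ d * d)) < (p : ℝ)) :
    ∀ᵐ ω ∂(percMeasure d p),
      (∃ I : (openGraph ω).ConnectedComponent, (I.supp.Infinite ∧
        ∀ I' : (openGraph ω).ConnectedComponent, I'.supp.Infinite → I' = I) ∧
        ∀ x : Fin d → ℤ, ∃ S : Set (Plaquette d), S.Finite ∧ IsSurface S ∧
          SeparatesFromInfinity S {x} ∧ (∀ π ∈ S, IsGood ω π) ∧
          ∀ π ∈ S, ∀ y ∈ π.1, y ∈ I.supp) ∧
        ω ∉ infiniteComponentEvent d := by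
  have h₁ : ∀ᵐ ω ∂(percMeasure d p), ∀ v, ∀ᶠ n in Filter.atTop, ¬ Far ω v n :=
    ae_all_iff.2 fun v => ae_eventually_not_far (by omega) hp fun _ => v
  have h₂ : ∀ᵐ ω ∂(percMeasure d p), ∀ a : Fin d → ℤ,
      ∀ᶠ n : ℕ in Filter.atTop, ¬ Far ω (a + n • unitVec ⟨0, by omega⟩) n :=
    ae_all_iff.2 fun a => ae_eventually_not_far (by omega) hp _
  filter_upwards [h₁, h₂] with ω hω₁ hω₂
  exact exists_unique_cluster_of_not_far (j := ⟨1, by omega⟩) (by simp)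
    (fun v => (hω₁ v).exists) hω₂

end PercPlaq

theorem mainTheorem6 (d : ℕ) (hd : 3 ≤ d) :
    PercPlaq.pFin d < 1 ∧
    ∃ p₀ : ℝ, p₀ < 1 ∧ ∀ p : unitInterval, p₀ < (p : ℝ) →
      ∀ᵐ ω ∂(PercPlaq.percMeasure d p),
        ∃ I : (PercPlaq.openGraph ω).ConnectedComponent,
          (I.supp.Infinite ∧
            ∀ I' : (PercPlaq.openGraph ω).ConnectedComponent, I'.supp.Infinite → I' = I) ∧
          ∀ x : Fin d → ℤ, ∃ S : Set (PercPlaq.Plaquette d),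
            S.Finite ∧ PercPlaq.IsSurface S ∧
            PercPlaq.SeparatesFromInfinity S {x} ∧
            (∀ π ∈ S, PercPlaq.IsGood ω π) ∧
            ∀ π ∈ S, ∀ y ∈ π.1, y ∈ I.supp := by
  have hC : (1 : ℝ) ≤ 2 * (3 ^ d * d) := by
    have h1 : (1 : ℝ) ≤ 3 ^ d := one_le_pow₀ (by norm_num)
    have h2 : (3 : ℝ) ≤ d := by exact_mod_cast hd
    nlinarith
  have hlt : 1 - 1 / (2 * (3 ^ d * d)) < (1 : ℝ) := by
    have : (0 : ℝ) < 1 / (2 * (3 ^ d * d)) := by positivity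
    linarith
  -- The real supremum of an empty set is 0, so the threshold must also be shown nonnegative; `hC`
  -- serves this.
  refine ⟨lt_of_le_of_lt (Real.sSup_le ?_ ?_) hlt, 1 - 1 / (2 * (3 ^ d * d)), hlt, fun p hp => ?_⟩
  · rintro p ⟨hp, hpos⟩
    by_contra hnot
    refine hpos.ne' (measure_mono_null (fun ω hω => ?_)
      (PercPlaq.ae_exists_unique_cluster (by omega) (p := ⟨p, hp⟩) (not_le.1 hnot)))
    exact fun h => h.2 hω
  · have : 1 / (2 * (3 ^ d * d)) ≤ (1 : ℝ) := (div_le_one (by linarith)).2 hC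
    linarith
  · exact (PercPlaq.ae_exists_unique_cluster (by omega) hp).mono fun _ h => h.1
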